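/- All Lie algebras are over $\mathbb{C}$. A biderivation of a Lie algebra $L$ is a bilinear map $\delta : L\times L\to L$ with $\delta([x,y],z)=[x,\delta(y,z)]-[y,\delta(x,z)]$ and $\delta(x,[y,z])=[y,\delta(x,z)]-[z,\delta(x,y)]$ for all $x,y,z\in L$; it is symmetric if $\delta(x,y)=\delta(y,x)$ for all $x,y$. Let $n\ge 1$ and let $H_n=\mathbb{C}^{2n}\oplus\mathbb{C}z$ be the Heisenberg Lie algebra, in which $z$ is central, $[e_i,e_{n+i}]=z$ for $1\le i\le n$, and all other brackets of basis vectors $e_j,e_k$ with $j<k$ are zero. Let $\mathfrak{sp}_{2n}(\mathbb{C})$ be the Lie algebra of the matrices $\begin{pmatrix}A&B\\ C&-A^{\mathrm T}\end{pmatrix}$ with $B=B^{\mathrm T}$ and $C=C^{\mathrm T}$. It acts on $H_n$ by derivations through $x\cdot v=xv$ for $v\in\mathbb{C}^{2n}$ and $x\cdot z=0$. (a) Let $\mathcal{S}_n=(\mathfrak{sl}_2(\mathbb{C})\oplus\mathfrak{sp}_{2n}(\mathbb{C}))\ltimes H_n$, where $\mathfrak{sp}_{2n}(\mathbb{C})$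 acts on $H_n$ as above and $\mathfrak{sl}_2(\mathbb{C})$ acts by zero (the only action of $\mathfrak{sl}_2(\mathbb{C})$ by derivations of $H_n$ that commutes with that of $\mathfrak{sp}_{2n}(\mathbb{C})$). Then the only symmetric biderivation of $\mathcal{S}_n$ is $\delta=0$. (b) Let $n\neq 2$ and let $\mathcal{S}_n'=(\mathfrak{sl}_2(\mathbb{C})\oplus\mathfrak{so}_n(\mathbb{C}))\ltimes H_n$ be the Schrödinger algebra in $(n+1)$-dimensional space-time, where $\mathfrak{so}_n(\mathbb{C})$ is the Lie algebra of skew-symmetric $n\times n$ matrices and, writing elements of $\mathbb{C}^{2n}$ as $(p,q)$ with $p,q\in\mathbb{C}^n$, the action on $H_n$ is $\begin{pmatrix}a&b\\ c&-a\end{pmatrix}\cdot(p,q)=(ap+bq,\,cp-aq)$, $A\cdot(p,q)=(Ap,Aq)$ for $A\in\mathfrak{so}_n(\mathbb{C})$, and $z$ is annihilated. Then the only symmetric biderivation of $\mathcal{S}_n'$ is $\delta=0$. -/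

import Mathlib

/-- The Heisenberg Lie algebra `H_n = ℂ^{2n} ⊕ ℂ z`: the element `⟨v, t⟩` stands for `v + t z`.
The standard basis of `ℂ^{2n}` is indexed by `Fin n ⊕ Fin n`, with `inl i` for `e_i` and `inr i`
for `e_{n+i}`. -/
@[ext]
structure HeisenbergAlgebra (n : ℕ) where
  /-- The component in `ℂ^{2n}`. -/
  vec : Fin n ⊕ Fin n → ℂ
  /-- The coefficient of the central element `z`. -/
  coeff : ℂ

namespace HeisenbergAlgebra

variable {n : ℕ}

/-- As a vector space, `H_n` is `ℂ^{2n} × ℂ`. -/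
def toProd : HeisenbergAlgebra n ≃ (Fin n ⊕ Fin n → ℂ) × ℂ where
  toFun x := (x.vec, x.coeff)
  invFun p := ⟨p.1, p.2⟩
  left_inv _ := rfl
  right_inv _ := rfl

instance : AddCommGroup (HeisenbergAlgebra n) := toProd.addCommGroup

noncomputable instance : Module ℂ (HeisenbergAlgebra n) := toProd.module ℂ

@[simp] theorem vec_zero : (0 : HeisenbergAlgebra n).vec = 0 := rfl
@[simp] theorem coeff_zero : (0 : HeisenbergAlgebra n).coeff = 0 := rfl
@[simp] theorem vec_add (x y : HeisenbergAlgebra n) : (x + y).vec = x.vec + y.vec := rfl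
@[simp] theorem coeff_add (x y : HeisenbergAlgebra n) : (x + y).coeff = x.coeff + y.coeff := rfl
@[simp] theorem vec_sub (x y : HeisenbergAlgebra n) : (x - y).vec = x.vec - y.vec := rfl
@[simp] theorem coeff_sub (x y : HeisenbergAlgebra n) : (x - y).coeff = x.coeff - y.coeff := rfl
@[simp] theorem vec_smul (c : ℂ) (x : HeisenbergAlgebra n) : (c • x).vec = c • x.vec := rfl
@[simp] theorem coeff_smul (c : ℂ) (x : HeisenbergAlgebra n) : (c • x).coeff = c * x.coeff := rfl

/-- The alternating form on `ℂ^{2n}` with `ω(e_i, e_{n+i}) = 1 = -ω(e_{n+i}, e_i)` and all other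
values on basis vectors zero. -/
noncomputable def omega (v w : Fin n ⊕ Fin n → ℂ) : ℂ :=
  ∑ i : Fin n, (v (Sum.inl i) * w (Sum.inr i) - v (Sum.inr i) * w (Sum.inl i))

/-- The bracket `[v + s z, w + t z] = ω(v, w) z`; so `[e_i, e_{n+i}] = z` and `z` is central. -/
noncomputable instance : Bracket (HeisenbergAlgebra n) (HeisenbergAlgebra n) where
  bracket x y := ⟨0, omega x.vec y.vec⟩

@[simp] theorem vec_lie (x y : HeisenbergAlgebra n) : ⁅x, y⁆.vec = 0 := rfl
@[simp] theorem coeff_lie (x y : HeisenbergAlgebra n) :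
    ⁅x, y⁆.coeff = omega x.vec y.vec := rfl

theorem omega_add_left (u v w : Fin n ⊕ Fin n → ℂ) :
    omega (u + v) w = omega u w + omega v w := by
  simp only [omega, ← Finset.sum_add_distrib, Pi.add_apply]
  exact Finset.sum_congr rfl fun i _ => by ring

theorem omega_add_right (u v w : Fin n ⊕ Fin n → ℂ) :
    omega u (v + w) = omega u v + omega u w := by
  simp only [omega, ← Finset.sum_add_distrib, Pi.add_apply]
  exact Finset.sum_congr rfl fun i _ => by ring

theorem omega_smul_right (c : ℂ) (v w : Fin n ⊕ Fin n → ℂ) :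
    omega v (c • w) = c * omega v w := by
  simp only [omega, Finset.mul_sum, Pi.smul_apply, smul_eq_mul]
  exact Finset.sum_congr rfl fun i _ => by ring

theorem omega_self (v : Fin n ⊕ Fin n → ℂ) : omega v v = 0 :=
  Finset.sum_eq_zero fun i _ => by ring

@[simp] theorem omega_zero_left (v : Fin n ⊕ Fin n → ℂ) : omega 0 v = 0 := by simp [omega]

@[simp] theorem omega_zero_right (v : Fin n ⊕ Fin n → ℂ) : omega v 0 = 0 := by simp [omega]

noncomputable instance : LieRing (HeisenbergAlgebra n) where
  add_lie x y z := by ext <;> simp [omega_add_left]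
  lie_add x y z := by ext <;> simp [omega_add_right]
  lie_self x := by ext <;> simp [omega_self]
  leibniz_lie x y z := by ext <;> simp

noncomputable instance : LieAlgebra ℂ (HeisenbergAlgebra n) where
  lie_smul c x y := by ext <;> simp [omega_smul_right]

theorem omega_eq_dotProduct (v w : Fin n ⊕ Fin n → ℂ) :
    omega v w = - (v ⬝ᵥ (Matrix.J (Fin n) ℂ).mulVec w) := by
  simp [omega, Matrix.J, Matrix.fromBlocks_mulVec, dotProduct, Fintype.sum_sum_type,
    Matrix.neg_mulVec, Finset.sum_add_distrib, sub_eq_add_neg, add_comm]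

/-- Matrices in `sp_{2n}` are skew for `ω`. -/
theorem omega_mulVec_add (M : LieAlgebra.Symplectic.sp (Fin n) ℂ) (v w : Fin n ⊕ Fin n → ℂ) :
    omega (M.val.mulVec v) w + omega v (M.val.mulVec w) = 0 := by
  have h : M.val.transpose * Matrix.J (Fin n) ℂ = Matrix.J (Fin n) ℂ * -M.val :=
    (mem_skewAdjointMatricesSubmodule _ _).1
      ((mem_skewAdjointMatricesLieSubalgebra _ _).1 M.property)
  rw [omega_eq_dotProduct, omega_eq_dotProduct, Matrix.mulVec_mulVec, ← Matrix.vecMul_transpose,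
    ← Matrix.dotProduct_mulVec, Matrix.mulVec_mulVec, h]
  simp [Matrix.neg_mulVec]

/-- The natural action of `sp_{2n}(ℂ)` on `H_n` by derivations: `[M, v] = M v` on `ℂ^{2n}` and
`[M, z] = 0`. -/
noncomputable def spAction (n : ℕ) :
    LieAlgebra.Symplectic.sp (Fin n) ℂ →ₗ⁅ℂ⁆
      LieDerivation ℂ (HeisenbergAlgebra n) (HeisenbergAlgebra n) where
  toFun M :=
    { toFun := fun x => ⟨M.val.mulVec x.vec, 0⟩
      map_add' := fun x y => by ext <;> simp [Matrix.mulVec_add]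
      map_smul' := fun c x => by ext <;> simp [Matrix.mulVec_smul]
      leibniz' := fun x y => by
        have h := omega_mulVec_add M x.vec y.vec
        ext
        · simp
        · have hs : omega y.vec (M.val.mulVec x.vec) = - omega (M.val.mulVec x.vec) y.vec := by
            have hz := omega_self (y.vec + M.val.mulVec x.vec)
            rw [omega_add_left, omega_add_right, omega_add_right, omega_self, omega_self] at hz
            linear_combination hz
          simp [hs]
          linear_combination -h }
  map_add' M N := by ext x <;> simp [Matrix.add_mulVec]
  map_smul' c M := by ext x <;> simp [Matrix.smul_mulVec]
  map_lie' {M N} := by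
    ext x <;> simp [Ring.lie_def, Matrix.sub_mulVec]

end HeisenbergAlgebra

/-- The homomorphism `sl_2(ℂ) ⊕ so_n(ℂ) → sp_{2n}(ℂ)` that describes the action on
`ℂ^{2n} = ℂ^2 ⊗ ℂ^n`. Writing an element of `ℂ^{2n}` as `(p, q)` with `p, q ∈ ℂ^n`, the matrix
`(a, b; c, d)` in `sl_2` sends it to `(a p + b q, c p + d q)`, and `A` in `so_n` sends it to
`(A p, A q)`. -/
noncomputable def slSoToSp (n : ℕ) :
    (LieAlgebra.SpecialLinear.sl (Fin 2) ℂ × LieAlgebra.Orthogonal.so (Fin n) ℂ) →ₗ⁅ℂ⁆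
      LieAlgebra.Symplectic.sp (Fin n) ℂ where
  toFun x :=
    ⟨Matrix.fromBlocks
      (x.1.val 0 0 • (1 : Matrix (Fin n) (Fin n) ℂ) + x.2.val)
      (x.1.val 0 1 • (1 : Matrix (Fin n) (Fin n) ℂ))
      (x.1.val 1 0 • (1 : Matrix (Fin n) (Fin n) ℂ))
      (x.1.val 1 1 • (1 : Matrix (Fin n) (Fin n) ℂ) + x.2.val), by
      have hA := (LieAlgebra.Orthogonal.mem_so (Fin n) ℂ x.2.val).1 x.2.property
      have hX : x.1.val 1 1 = - x.1.val 0 0 := by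
        have h := (LinearMap.mem_ker (f := Matrix.traceLinearMap (Fin 2) ℂ ℂ)).1 x.1.property
        rw [Matrix.traceLinearMap_apply, Matrix.trace_fin_two] at h
        linear_combination h
      rw [LieAlgebra.Symplectic.sp, mem_skewAdjointMatricesLieSubalgebra,
        mem_skewAdjointMatricesSubmodule]
      change _ * _ = _ * _
      simp [Matrix.J, Matrix.fromBlocks_transpose, Matrix.fromBlocks_multiply,
        Matrix.fromBlocks_neg, hA, hX]
      constructor <;> abel⟩
  map_add' x y := by
    ext1
    simp only [Prod.fst_add, Prod.snd_add, AddMemClass.coe_add, Matrix.add_apply, add_smul,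
      Matrix.fromBlocks_add]
    congr 1
    · abel
    · abel
  map_smul' c x := by
    ext1
    simp [Matrix.fromBlocks_smul, mul_smul]
  map_lie' {x y} := by
    ext1
    simp only [LieAlgebra.Prod.bracket_apply, LieSubalgebra.coe_bracket, Ring.lie_def,
      Matrix.fromBlocks_multiply, Matrix.sub_apply, Matrix.mul_apply, Fin.sum_univ_two,
      sub_eq_add_neg, Matrix.fromBlocks_neg, Matrix.fromBlocks_add]
    congr 1 <;>
    · simp only [mul_add, add_mul, Matrix.smul_mul, Matrix.mul_smul, one_mul, mul_one]
      module

/-- The Lie algebra `(sl_2(ℂ) ⊕ sp_{2n}(ℂ)) ⋉ H_n`, where `sp_{2n}` acts on `H_n` naturally and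
`sl_2` acts by zero. For `n ≥ 1` this is the only semidirect product of this shape in which
`sp_{2n}` acts naturally: the operators by which `sl_2` acts commute with the diagonal matrices of
`sp_{2n}`, whose weights on `H_n` are pairwise distinct, so they are simultaneously diagonal, and
`sl_2` is perfect. -/
abbrev SchrodingerSp (n : ℕ) : Type :=
  LieAlgebra.SemiDirectSum (HeisenbergAlgebra n)
    (LieAlgebra.SpecialLinear.sl (Fin 2) ℂ × LieAlgebra.Symplectic.sp (Fin n) ℂ)
    ((HeisenbergAlgebra.spAction n).comp
      (LieHom.snd ℂ (LieAlgebra.SpecialLinear.sl (Fin 2) ℂ)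
        (LieAlgebra.Symplectic.sp (Fin n) ℂ)))

/-- The Schrödinger algebra `(sl_2(ℂ) ⊕ so_n(ℂ)) ⋉ H_n` of `(n+1)`-dimensional space-time, where
`sl_2 ⊕ so_n` acts on `ℂ^{2n} = ℂ^2 ⊗ ℂ^n` naturally and kills `z`. -/
abbrev SchrodingerSO (n : ℕ) : Type :=
  LieAlgebra.SemiDirectSum (HeisenbergAlgebra n)
    (LieAlgebra.SpecialLinear.sl (Fin 2) ℂ × LieAlgebra.Orthogonal.so (Fin n) ℂ)
    ((HeisenbergAlgebra.spAction n).comp (slSoToSp n))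

/-- A bilinear map `δ : L × L → V` into an `L`-module is a biderivation if it is a derivation in
each of its two arguments. -/
structure IsBiderivation {L V : Type*} [LieRing L] [LieAlgebra ℂ L] [AddCommGroup V] [Module ℂ V]
    [LieRingModule L V] [LieModule ℂ L V] (δ : L →ₗ[ℂ] L →ₗ[ℂ] V) : Prop where
  lie_left : ∀ x y z : L, δ ⁅x, y⁆ z = ⁅x, δ y z⁆ - ⁅y, δ x z⁆
  lie_right : ∀ x y z : L, δ x ⁅y, z⁆ = ⁅y, δ x z⁆ - ⁅z, δ x y⁆

/-- A symmetric biderivation: a biderivation `δ` with `δ(x, y) = δ(y, x)`. -/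
structure IsSymmBiderivation {L V : Type*} [LieRing L] [LieAlgebra ℂ L] [AddCommGroup V]
    [Module ℂ V] [LieRingModule L V] [LieModule ℂ L V] (δ : L →ₗ[ℂ] L →ₗ[ℂ] V) : Prop
    extends IsBiderivation δ where
  symm : ∀ x y : L, δ x y = δ y x

/-! ### Symmetric biderivations and `sl₂`-triples in an arbitrary Lie algebra. -/

section SymmetricBiderivations

/-! Take an `sl₂`-triple for which the Casimir operator `h² + 2h + 4fe`, which is `m(m+2)` in
highest weight `m`, kills only invariants. Symmetry of `δ` forces the Casimir to kill `δ h h`. Hence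
`δ` vanishes on pairs from the triple, and comparing weights gives `δ s = 0` for each `s` in the
triple. If `δ s = 0`, then `ad s` moves freely in and out of either argument, so `ad s` and `ad t`
commute on values of `δ` whenever `δ s = δ t = 0`. Since `sl₂` is perfect, all values are invariant
under the triple, and `δ` kills every `[s, a]`, that is, all nontrivial `sl₂`-components. The set of
`x` with `δ x = 0` is also closed under brackets. For `sp`, the triple is embedded diagonally in
`sl₂ ⊕ sp`. It reaches `ℂ^{2n}` and the off-diagonal blocks of `sp`, whose brackets give `z` and the
diagonal blocks. For `so`, the triple of `sl₂` reaches `sl₂` and `H_n` but not `so_n`. Since `δ`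
kills the ideal `H_n`, its values centralize `H_n` and so lie in `ℂz`. Hence `δ` kills all brackets,
and `so_n` is perfect for `n ≠ 2`. -/

theorem IsSl2Triple.lie_e_lie_f {L : Type*} [LieRing L] {h e f : L} (t : IsSl2Triple h e f)
    (x : L) : ⁅e, ⁅f, x⁆⁆ = ⁅h, x⁆ + ⁅f, ⁅e, x⁆⁆ := by
  rw [leibniz_lie, t.lie_e_f]

variable {L : Type*} [LieRing L] [LieAlgebra ℂ L] {δ : L →ₗ[ℂ] L →ₗ[ℂ] L} {h e f : L}

/-- The Casimir operator of the triple `(h, e, f)` kills only vectors that are invariant under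
the triple. -/
def CasimirDetectsInvariants (h e f : L) : Prop :=
  ∀ x : L, ⁅h, ⁅h, x⁆⁆ + (2 : ℂ) • ⁅h, x⁆ + (4 : ℂ) • ⁅f, ⁅e, x⁆⁆ = 0 →
    ⁅h, x⁆ = 0 ∧ ⁅e, x⁆ = 0 ∧ ⁅f, x⁆ = 0

theorem IsSl2Triple.lie_h_e (t : IsSl2Triple h e f) : ⁅h, e⁆ = (2 : ℂ) • e := by
  rw [t.lie_h_e_nsmul, two_smul, two_smul]

theorem IsSl2Triple.lie_h_f (t : IsSl2Triple h e f) : ⁅h, f⁆ = (-2 : ℂ) • f := by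
  rw [t.lie_h_f_nsmul, neg_smul, two_smul, two_smul]

theorem IsSl2Triple.lie_h_lie_e (t : IsSl2Triple h e f) (x : L) :
    ⁅h, ⁅e, x⁆⁆ = (2 : ℂ) • ⁅e, x⁆ + ⁅e, ⁅h, x⁆⁆ := by
  rw [leibniz_lie, t.lie_h_e, smul_lie]

theorem IsSl2Triple.lie_h_lie_f (t : IsSl2Triple h e f) (x : L) :
    ⁅h, ⁅f, x⁆⁆ = (-2 : ℂ) • ⁅f, x⁆ + ⁅f, ⁅h, x⁆⁆ := by
  rw [leibniz_lie, t.lie_h_f, smul_lie]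

/-- The Casimir of the opposite triple is the same operator: `h² - 2h + 4ef = h² + 2h + 4fe`, since
`ef = h + fe`. Results for `e` thus transfer to `f`. -/
theorem CasimirDetectsInvariants.symm (t : IsSl2Triple h e f)
    (hK : CasimirDetectsInvariants h e f) : CasimirDetectsInvariants (-h) f e := by
  intro x hx
  simp only [neg_lie, lie_neg] at hx ⊢
  obtain ⟨h1, h2, h3⟩ := hK x (by rw [t.lie_e_lie_f] at hx; linear_combination (norm := module) hx)
  exact ⟨by rw [h1, neg_zero], h3, h2⟩

theorem IsSymmBiderivation.cyclic (hδ : IsSymmBiderivation δ) (a b c : L) :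
    δ ⁅a, b⁆ c + δ ⁅b, c⁆ a + δ ⁅c, a⁆ b = 0 := by
  rw [hδ.lie_left, hδ.lie_left, hδ.lie_left, hδ.symm c a, hδ.symm b a, hδ.symm c b]
  abel

/-- A vector of weight `2` that is killed by `f` vanishes. -/
theorem CasimirDetectsInvariants.eq_zero (t : IsSl2Triple h e f)
    (hK : CasimirDetectsInvariants h e f) {x : L} (h1 : ⁅h, x⁆ = (2 : ℂ) • x)
    (h2 : ⁅e, ⁅f, x⁆⁆ = 0) : x = 0 := by
  -- Here `fe x = ef x - h x = -2x`, so the Casimir acts by `4 + 4 - 8 = 0`.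
  have h3 := t.lie_e_lie_f x
  have h4 := (hK x (by
    rw [h1, lie_smul, h1]
    rw [h2, h1] at h3
    linear_combination (norm := module) (-4 : ℂ) • h3)).1
  rw [h1] at h4
  exact (smul_eq_zero.1 h4).resolve_left two_ne_zero

/-- With `w = δ h h` and `p = δ h e`, the cyclic identity gives `δ e f = -w/4`, and the derivation
rules express both `fe w` and `f p` through `w`. Together they say that the Casimir kills `w`. -/
theorem IsSymmBiderivation.apply_h_e (t : IsSl2Triple h e f)
    (hK : CasimirDetectsInvariants h e f) (hδ : IsSymmBiderivation δ) :
    δ h h = 0 ∧ δ h e = 0 ∧ δ e f = 0 ∧ δ e e = 0 := by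
  have c := hδ.cyclic h e f
  rw [← lie_skew f h, t.lie_h_e, t.lie_h_f, t.lie_e_f, hδ.symm _ e] at c
  simp only [map_smul, LinearMap.smul_apply, map_neg] at c
  have p1 := hδ.lie_right h h e
  have p2 := hδ.lie_right e h f
  rw [t.lie_h_e, map_smul] at p1
  rw [t.lie_h_f, map_smul, hδ.symm e h] at p2
  have ef : δ e f = (-(1 / 4) : ℂ) • δ h h := by
    linear_combination (norm := module) (1 / 4 : ℂ) • c
  have fp : ⁅f, δ h e⁆ = (-(1 / 4) : ℂ) • (⁅h, δ h h⁆ + (2 : ℂ) • δ h h) := by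
    rw [ef, lie_smul] at p2
    linear_combination (norm := module) p2
  have few : ⁅f, ⁅e, δ h h⁆⁆ = ⁅h, ⁅f, δ h e⁆⁆ := by
    have := congrArg (fun y => ⁅f, y⁆) p1
    simp only [lie_smul, lie_sub] at this
    rw [t.lie_h_lie_f]
    linear_combination (norm := module) this
  obtain ⟨hw, ew, -⟩ := hK (δ h h) (by
    rw [few, fp, lie_smul, lie_add, lie_smul]
    module)
  rw [hw] at fp
  rw [ew] at p1
  -- Once `w` is invariant, `p` has weight `2` and `f p = -w/2` is killed by `e`.
  have p0 : δ h e = 0 := hK.eq_zero t (by linear_combination (norm := module) (-1 : ℂ) • p1)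
    (by rw [fp, lie_smul, zero_add, lie_smul, ew, smul_zero, smul_zero])
  have w0 : δ h h = 0 := by
    rw [p0, lie_zero] at fp
    linear_combination (norm := module) (2 : ℂ) • fp
  rw [w0, smul_zero] at ef
  refine ⟨w0, p0, ef, hK.eq_zero t ?_ ?_⟩
  · have := hδ.lie_right e h e
    rw [t.lie_h_e, map_smul, hδ.symm e h, p0, lie_zero, sub_zero] at this
    exact this.symm
  · have := hδ.lie_right e e f
    rw [t.lie_e_f, hδ.symm e h, p0, ef, lie_zero, zero_sub, zero_eq_neg] at this
    rw [this, lie_zero]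

/-- A symmetric biderivation vanishes on an `sl₂`-triple whose Casimir operator detects
invariants. -/
theorem IsSymmBiderivation.apply_triple (t : IsSl2Triple h e f)
    (hK : CasimirDetectsInvariants h e f) (hδ : IsSymmBiderivation δ) :
    ∀ s ∈ ({h, e, f} : Set L), ∀ s' ∈ ({h, e, f} : Set L), δ s s' = 0 := by
  obtain ⟨hh, he, ef, ee⟩ := hδ.apply_h_e t hK
  obtain ⟨-, hf, -, ff⟩ := hδ.apply_h_e t.symm (hK.symm t)
  rw [map_neg, LinearMap.neg_apply, neg_eq_zero] at hf
  rintro s (rfl | rfl | rfl) s' (rfl | rfl | rfl)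
  · exact hh
  · exact he
  · exact hf
  · exact (hδ.symm _ _).trans he
  · exact ee
  · exact ef
  · exact (hδ.symm _ _).trans hf
  · exact (hδ.symm _ _).trans ef
  · exact ff

theorem IsSymmBiderivation.apply_lie_of_apply_eq_zero (hδ : IsSymmBiderivation δ) {s s' : L}
    (h0 : δ s s' = 0) (x : L) : δ s ⁅s', x⁆ = ⁅s', δ s x⁆ := by
  rw [hδ.lie_right, h0, lie_zero, sub_zero]

theorem IsSymmBiderivation.apply_e (t : IsSl2Triple h e f)
    (hK : CasimirDetectsInvariants h e f) (hδ : IsSymmBiderivation δ) : δ e = 0 := by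
  have z := hδ.apply_triple t hK
  have zeh := hδ.apply_lie_of_apply_eq_zero (z e (by simp) h (by simp))
  have zef := hδ.apply_lie_of_apply_eq_zero (z e (by simp) f (by simp))
  have zhh := hδ.apply_lie_of_apply_eq_zero (z h (by simp) h (by simp))
  have key (x : L) : (2 : ℂ) • δ e x = ⁅h, δ e x⁆ - ⁅e, δ h x⁆ := by
    rw [← hδ.lie_left, t.lie_h_e, map_smul, LinearMap.smul_apply]
  -- Both `δ e` and `δ h` commute with `ad h`, so `key` at `[h, x]` and `ad h` of `key` differ only
  -- by the commutator `he - eh = 2e`.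
  have ehx (x : L) : ⁅e, δ h x⁆ = 0 := by
    have k1 := key ⁅h, x⁆
    have k2 := congrArg (fun y => ⁅h, y⁆) (key x)
    simp only [lie_smul, lie_sub] at k2
    rw [zeh, zhh] at k1
    rw [t.lie_h_lie_e] at k2
    linear_combination (norm := module) (1 / 2 : ℂ) • (k2 - k1)
  have hx (x : L) : ⁅h, δ e x⁆ = (2 : ℂ) • δ e x := by
    rw [key, ehx, sub_zero]
  -- As `δ e [f, x] = [f, δ e x]`, this vector has weight `2` by `hx`, but weight `0` because `f`
  -- lowers the weight of `δ e x` by `2`.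
  have fx (x : L) : ⁅f, δ e x⁆ = 0 := by
    have k1 := hx ⁅f, x⁆
    rw [zef, t.lie_h_lie_f, hx, lie_smul] at k1
    linear_combination (norm := module) (-1 / 2 : ℂ) • k1
  ext x
  exact hK.eq_zero t (hx x) (by rw [fx, lie_zero])

/-- A symmetric biderivation vanishes if one argument lies in an `sl₂`-triple whose Casimir
operator detects invariants. -/
theorem IsSymmBiderivation.apply_mem_triple (t : IsSl2Triple h e f)
    (hK : CasimirDetectsInvariants h e f) (hδ : IsSymmBiderivation δ) :
    ∀ s ∈ ({h, e, f} : Set L), δ s = 0 := by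
  have he := hδ.apply_e t hK
  have hf := hδ.apply_e t.symm (hK.symm t)
  rintro s (rfl | rfl | rfl)
  · ext x
    rw [← t.lie_e_f, hδ.lie_left, he, hf]
    simp
  · exact he
  · exact hf

theorem IsSymmBiderivation.lie_apply_of_apply_eq_zero (hδ : IsSymmBiderivation δ) {s : L}
    (h0 : δ s = 0) (a b : L) : δ ⁅s, a⁆ b = ⁅s, δ a b⁆ ∧ δ a ⁅s, b⁆ = ⁅s, δ a b⁆ := by
  rw [hδ.lie_left, hδ.lie_right, hδ.symm a s, h0]
  simp

/-- If `δ` vanishes at `s` and at `t`, then its values commute with `[s, t]`. -/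
theorem IsSymmBiderivation.lie_lie_apply (hδ : IsSymmBiderivation δ) {s t : L}
    (hs : δ s = 0) (ht : δ t = 0) (a b : L) : ⁅⁅s, t⁆, δ a b⁆ = 0 := by
  rw [lie_lie, ← (hδ.lie_apply_of_apply_eq_zero ht a b).2,
    ← (hδ.lie_apply_of_apply_eq_zero hs a _).1, (hδ.lie_apply_of_apply_eq_zero ht _ b).2,
    (hδ.lie_apply_of_apply_eq_zero hs a b).1, sub_self]

/-- The values of a symmetric biderivation are invariant under an `sl₂`-triple whose Casimir
operator detects invariants. -/
theorem IsSymmBiderivation.lie_apply (t : IsSl2Triple h e f)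
    (hK : CasimirDetectsInvariants h e f) (hδ : IsSymmBiderivation δ) :
    ∀ s ∈ ({h, e, f} : Set L), ∀ a b : L, ⁅s, δ a b⁆ = 0 := by
  have z := hδ.apply_mem_triple t hK
  have zh := z h (by simp)
  have ze := z e (by simp)
  have zf := z f (by simp)
  rintro s (rfl | rfl | rfl) a b
  · rw [← t.lie_e_f, hδ.lie_lie_apply ze zf]
  · have := hδ.lie_lie_apply zh ze a b
    rw [t.lie_h_e, smul_lie] at this
    exact (smul_eq_zero.1 this).resolve_left two_ne_zero
  · have := hδ.lie_lie_apply zh zf a b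
    rw [t.lie_h_f, smul_lie] at this
    exact (smul_eq_zero.1 this).resolve_left (by norm_num)

theorem IsSymmBiderivation.apply_lie_mem_triple (t : IsSl2Triple h e f)
    (hK : CasimirDetectsInvariants h e f) (hδ : IsSymmBiderivation δ) :
    ∀ s ∈ ({h, e, f} : Set L), ∀ a : L, δ ⁅s, a⁆ = 0 := by
  intro s hs a
  ext b
  rw [(hδ.lie_apply_of_apply_eq_zero (hδ.apply_mem_triple t hK s hs) a b).1,
    hδ.lie_apply t hK s hs, LinearMap.zero_apply]

theorem IsSymmBiderivation.apply_lie_eq_zero (hδ : IsSymmBiderivation δ) {x y : L}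
    (hx : δ x = 0) (hy : δ y = 0) : δ ⁅x, y⁆ = 0 := by
  ext b
  rw [hδ.lie_left, hx, hy]
  simp

end SymmetricBiderivations

/-! ### The standard triple of `sl₂` and its adjoint Casimir. -/

section Sl2

open LieAlgebra.SpecialLinear

/-- The element `(1, 0; 0, -1)` of `sl₂`. -/
noncomputable def slH : sl (Fin 2) ℂ := ⟨!![1, 0; 0, -1], by
  rw [sl]; exact LinearMap.mem_ker.2 (by simp [Matrix.trace_fin_two])⟩

/-- The element `(0, 1; 0, 0)` of `sl₂`. -/
noncomputable def slE : sl (Fin 2) ℂ := ⟨!![0, 1; 0, 0], by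
  rw [sl]; exact LinearMap.mem_ker.2 (by simp [Matrix.trace_fin_two])⟩

/-- The element `(0, 0; 1, 0)` of `sl₂`. -/
noncomputable def slF : sl (Fin 2) ℂ := ⟨!![0, 0; 1, 0], by
  rw [sl]; exact LinearMap.mem_ker.2 (by simp [Matrix.trace_fin_two])⟩

theorem isSl2Triple_sl : IsSl2Triple slH slE slF where
  h_ne_zero h := by simpa [slH] using congrFun₂ (congrArg Subtype.val h) 0 0
  lie_e_f := by
    ext i j
    fin_cases i <;> fin_cases j <;> simp [slH, slE, slF, Ring.lie_def]
  lie_h_e_nsmul := by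
    ext i j
    fin_cases i <;> fin_cases j <;>
      simp [slH, slE, Ring.lie_def]
    norm_num
  lie_h_f_nsmul := by
    ext i j
    fin_cases i <;> fin_cases j <;>
      simp [slH, slF, Ring.lie_def]
    norm_num

theorem sl_one_one (X : sl (Fin 2) ℂ) : X.val 1 1 = - X.val 0 0 := by
  have h := (LinearMap.mem_ker (f := Matrix.traceLinearMap (Fin 2) ℂ ℂ)).1 X.property
  rw [Matrix.traceLinearMap_apply, Matrix.trace_fin_two] at h
  linear_combination h

theorem sl_eq_smul_add (X : sl (Fin 2) ℂ) :
    X = X.val 0 0 • slH + X.val 0 1 • slE + X.val 1 0 • slF := by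
  ext i j
  fin_cases i <;> fin_cases j <;> simp [slH, slE, slF, sl_one_one]

/-- The adjoint module has highest weight `m = 2`, and `m(m+2) = 8`. -/
theorem sl_casimir (X : sl (Fin 2) ℂ) :
    ⁅slH, ⁅slH, X⁆⁆ + (2 : ℂ) • ⁅slH, X⁆ + (4 : ℂ) • ⁅slF, ⁅slE, X⁆⁆ = (8 : ℂ) • X := by
  have hX : X.val = !![X.val 0 0, X.val 0 1; X.val 1 0, -X.val 0 0] := by
    rw [← sl_one_one]
    exact Matrix.eta_fin_two _
  generalize X.val 0 0 = a, X.val 0 1 = b, X.val 1 0 = c at hX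
  ext i j
  simp only [LieSubalgebra.coe_bracket, AddMemClass.coe_add, SetLike.val_smul, Ring.lie_def, hX,
    slH, slE, slF]
  fin_cases i <;> fin_cases j <;> simp <;> ring

end Sl2

/-! ### The action of `sl₂` on the Heisenberg algebra. -/

namespace HeisenbergAlgebra

open LieAlgebra.SpecialLinear

variable {n : ℕ}

theorem slSoToSp_mulVec_inl (X : sl (Fin 2) ℂ) (A : LieAlgebra.Orthogonal.so (Fin n) ℂ)
    (v : Fin n ⊕ Fin n → ℂ) (i : Fin n) :
    (slSoToSp n (X, A)).val.mulVec v (Sum.inl i) = X.val 0 0 * v (Sum.inl i) +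
      A.val.mulVec (v ∘ Sum.inl) i + X.val 0 1 * v (Sum.inr i) := by
  simp [slSoToSp, Matrix.fromBlocks_mulVec, Matrix.add_mulVec, Matrix.smul_mulVec]

theorem slSoToSp_mulVec_inr (X : sl (Fin 2) ℂ) (A : LieAlgebra.Orthogonal.so (Fin n) ℂ)
    (v : Fin n ⊕ Fin n → ℂ) (i : Fin n) :
    (slSoToSp n (X, A)).val.mulVec v (Sum.inr i) = X.val 1 0 * v (Sum.inl i) +
      (X.val 1 1 * v (Sum.inr i) + A.val.mulVec (v ∘ Sum.inr) i) := by
  simp [slSoToSp, Matrix.fromBlocks_mulVec, Matrix.add_mulVec, Matrix.smul_mulVec]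

@[simp] theorem spAction_vec (M : LieAlgebra.Symplectic.sp (Fin n) ℂ) (x : HeisenbergAlgebra n) :
    (spAction n M x).vec = M.val.mulVec x.vec := rfl

@[simp] theorem spAction_coeff (M : LieAlgebra.Symplectic.sp (Fin n) ℂ)
    (x : HeisenbergAlgebra n) : (spAction n M x).coeff = 0 := rfl

/-- `ℂ^{2n}` is `n` copies of the module with `m = 1`, where `m(m+2) = 3`; the invariant `z`
contributes `0`. -/
theorem slSoToSp_casimir (x : HeisenbergAlgebra n) :
    spAction n (slSoToSp n (slH, 0)) (spAction n (slSoToSp n (slH, 0)) x) +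
      (2 : ℂ) • spAction n (slSoToSp n (slH, 0)) x +
      (4 : ℂ) • spAction n (slSoToSp n (slF, 0)) (spAction n (slSoToSp n (slE, 0)) x) =
      (3 : ℂ) • ⟨x.vec, 0⟩ := by
  ext i
  · rcases i with i | i <;>
      simp [slSoToSp_mulVec_inl, slSoToSp_mulVec_inr, slH, slE, slF,
        -Matrix.mulVec_mulVec] <;> ring
  · simp

theorem spAction_eq_zero (M : LieAlgebra.Symplectic.sp (Fin n) ℂ) {x : HeisenbergAlgebra n}
    (h : x.vec = 0) : spAction n M x = 0 := by
  ext <;> simp [h]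

theorem vec_eq_zero_of_omega {u : Fin n ⊕ Fin n → ℂ} (h : ∀ v, omega v u = 0) : u = 0 := by
  ext i
  rcases i with i | i
  · simpa [omega, Pi.single_apply] using h (Pi.single (Sum.inr i) 1)
  · simpa [omega, Pi.single_apply] using h (Pi.single (Sum.inl i) 1)

theorem exists_omega_eq_one (hn : 1 ≤ n) : ∃ v w : Fin n ⊕ Fin n → ℂ, omega v w = 1 :=
  ⟨Pi.single (Sum.inl ⟨0, hn⟩) 1, Pi.single (Sum.inr ⟨0, hn⟩) 1, by
    simp [omega, Pi.single_apply]⟩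

end HeisenbergAlgebra

/-! ### The Schrödinger algebra with `so_n`. -/

section SO

open LieAlgebra.SpecialLinear LieAlgebra.Orthogonal HeisenbergAlgebra

variable {n : ℕ}

namespace SchrodingerSO

theorem lie_def (x y : SchrodingerSO n) : ⁅x, y⁆ =
    ⟨⁅x.left, y.left⁆ + spAction n (slSoToSp n x.right) y.left -
      spAction n (slSoToSp n y.right) x.left, ⁅x.right, y.right⁆⟩ := rfl

/-- The inclusion of `sl₂` into the Schrödinger algebra. -/
noncomputable def ofSl (X : sl (Fin 2) ℂ) : SchrodingerSO n := ⟨0, (X, 0)⟩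

/-- The inclusion of `H_n` into the Schrödinger algebra. -/
noncomputable def ofHeis (v : HeisenbergAlgebra n) : SchrodingerSO n := ⟨v, 0⟩

theorem ofSl_lie (X : sl (Fin 2) ℂ) (y : SchrodingerSO n) :
    ⁅(ofSl X : SchrodingerSO n), y⁆ =
      ⟨spAction n (slSoToSp n (X, 0)) y.left, (⁅X, y.right.1⁆, 0)⟩ := by
  rw [lie_def]
  simp [ofSl]

theorem isSl2Triple : IsSl2Triple (ofSl slH : SchrodingerSO n) (ofSl slE) (ofSl slF) where
  h_ne_zero h := isSl2Triple_sl.h_ne_zero (congrArg (fun x => x.right.1) h)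
  lie_e_f := by
    rw [ofSl_lie, ofSl, ofSl, isSl2Triple_sl.lie_e_f]; simp
  lie_h_e_nsmul := by
    rw [ofSl_lie, ofSl, isSl2Triple_sl.lie_h_e_nsmul, two_smul, two_smul]; simp
  lie_h_f_nsmul := by
    rw [ofSl_lie, ofSl, isSl2Triple_sl.lie_h_f_nsmul, two_smul, two_smul]; simp

theorem casimirDetectsInvariants :
    CasimirDetectsInvariants (ofSl slH : SchrodingerSO n) (ofSl slE) (ofSl slF) := by
  intro x hx
  simp only [ofSl_lie, LieAlgebra.SemiDirectSum.add_eq_mk, LieAlgebra.SemiDirectSum.smul_eq_mk,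
    LieAlgebra.SemiDirectSum.zero_eq_mk, LieAlgebra.SemiDirectSum.mk.injEq, slSoToSp_casimir,
    Prod.smul_mk, Prod.mk_add_mk, sl_casimir] at hx ⊢
  have h1 : x.left.vec = 0 :=
    congrArg vec ((smul_eq_zero.1 hx.1).resolve_left (by norm_num))
  have h2 : x.right.1 = 0 :=
    (smul_eq_zero.1 (congrArg Prod.fst hx.2)).resolve_left (by norm_num)
  simp only [h2, lie_zero, spAction_eq_zero _ h1]
  simp

variable {δ : SchrodingerSO n →ₗ[ℂ] SchrodingerSO n →ₗ[ℂ] SchrodingerSO n}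

theorem apply_ofHeis (hn : 1 ≤ n) (hδ : IsSymmBiderivation δ) (v : HeisenbergAlgebra n) :
    δ (ofHeis v) = 0 := by
  -- `slH` acts on `ℂ^{2n}` with eigenvalues `±1`, so `v = [h, [h, v]]`.
  have key (v : Fin n ⊕ Fin n → ℂ) : δ (ofHeis ⟨v, 0⟩) = 0 := by
    rw [← hδ.apply_lie_mem_triple isSl2Triple casimirDetectsInvariants (ofSl slH : SchrodingerSO n) (by simp)
      ⁅(ofSl slH : SchrodingerSO n), (ofHeis ⟨v, 0⟩ : SchrodingerSO n)⁆]
    congr 1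
    rw [ofSl_lie, ofSl_lie, ofHeis]
    ext i
    · rcases i with i | i <;> simp [slSoToSp_mulVec_inl, slSoToSp_mulVec_inr, slH]
    · simp
    · simp
    · simp
  obtain ⟨u, w, huw⟩ := exists_omega_eq_one hn
  have hv : ofHeis v = ofHeis ⟨v.vec, 0⟩ + v.coeff •
      (⁅ofHeis ⟨u, 0⟩, ofHeis ⟨w, 0⟩⁆ : SchrodingerSO n) := by
    rw [lie_def]
    ext i <;> simp [ofHeis, huw]
  rw [hv, map_add, map_smul, hδ.apply_lie_eq_zero (key u) (key w), key, smul_zero, add_zero]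

/-- The centralizer of `H_n` is `ℂz`: nondegeneracy of `ω` removes the vector part, and for `n ≥ 1`
the action of `sl₂ ⊕ so_n` on `ℂ^{2n}` is faithful. -/
theorem lie_eq_zero_of_lie_ofHeis (hn : 1 ≤ n) {c : SchrodingerSO n}
    (hc : ∀ v : HeisenbergAlgebra n, ⁅ofHeis v, c⁆ = 0) (x : SchrodingerSO n) : ⁅x, c⁆ = 0 := by
  have hleft (v : Fin n ⊕ Fin n → ℂ) := congrArg LieAlgebra.SemiDirectSum.left (hc ⟨v, 0⟩)
  simp only [lie_def, ofHeis] at hleft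
  have hu : c.left.vec = 0 := vec_eq_zero_of_omega fun v => by
    simpa using congrArg coeff (hleft v)
  have hM (v : Fin n ⊕ Fin n → ℂ) : (slSoToSp n c.right).val.mulVec v = 0 := by
    simpa using congrArg vec (hleft v)
  have hA := (mem_so (Fin n) ℂ c.right.2.val).1 c.right.2.property
  have hAd (i : Fin n) : c.right.2.val i i = 0 := by
    have := congrFun₂ hA i i
    rw [Matrix.transpose_apply, Matrix.neg_apply] at this
    linear_combination this / 2
  have hM0 : (slSoToSp n c.right).val = 0 := Matrix.ext_of_mulVec_single fun i => by
    rw [hM, Matrix.zero_mulVec]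
  have h00 : c.right.1.val 0 0 = 0 := by
    simpa [slSoToSp, hAd] using congrFun₂ hM0 (Sum.inl ⟨0, hn⟩) (Sum.inl ⟨0, hn⟩)
  have h01 : c.right.1.val 0 1 = 0 := by
    simpa [slSoToSp] using congrFun₂ hM0 (Sum.inl ⟨0, hn⟩) (Sum.inr ⟨0, hn⟩)
  have h10 : c.right.1.val 1 0 = 0 := by
    simpa [slSoToSp] using congrFun₂ hM0 (Sum.inr ⟨0, hn⟩) (Sum.inl ⟨0, hn⟩)
  have hX : c.right.1 = 0 := by
    rw [sl_eq_smul_add c.right.1, h00, h01, h10]; simp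
  have hA0 : c.right.2 = 0 := by
    ext i j
    simpa [slSoToSp, h00] using congrFun₂ hM0 (Sum.inl i) (Sum.inl j)
  have hr : c.right = 0 := Prod.ext hX hA0
  rw [lie_def, hr]
  ext <;> simp [hu]

/-- The values of a symmetric biderivation are central. -/
theorem lie_apply_eq_zero (hn : 1 ≤ n) (hδ : IsSymmBiderivation δ) (x a b : SchrodingerSO n) :
    ⁅x, δ a b⁆ = 0 := by
  refine lie_eq_zero_of_lie_ofHeis hn (fun v => ?_) x
  -- `H_n` is an ideal, so `[v, δ a b] = δ [v, a] b` is a value of `δ` at an element of `H_n`.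
  have h : ⁅(ofHeis v : SchrodingerSO n), a⁆ = ofHeis ⁅ofHeis v, a⁆.left := by
    rw [lie_def]
    simp [ofHeis]
  rw [← (hδ.lie_apply_of_apply_eq_zero (apply_ofHeis hn hδ v) a b).1, h, apply_ofHeis hn hδ,
    LinearMap.zero_apply]

/-- The inclusion of `so_n` into the Schrödinger algebra. -/
noncomputable def ofSo : so (Fin n) ℂ →ₗ[ℂ] SchrodingerSO n where
  toFun A := ⟨0, (0, A)⟩
  map_add' A B := by simp
  map_smul' c A := by simp

theorem lie_ofSo (A B : so (Fin n) ℂ) : ⁅ofSo A, ofSo B⁆ = ofSo ⁅A, B⁆ := by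
  rw [lie_def]
  simp [ofSo]

end SchrodingerSO

/-- The projection of matrices onto the skew-symmetric ones, up to a factor `2`. -/
noncomputable def skewPart (n : ℕ) : Matrix (Fin n) (Fin n) ℂ →ₗ[ℂ] so (Fin n) ℂ where
  toFun M := ⟨M - M.transpose, by rw [mem_so]; simp⟩
  map_add' M N := by ext1; simp; abel
  map_smul' c M := by ext1; simp [smul_sub]

theorem skewPart_val (A : so (Fin n) ℂ) : skewPart n A.val = (2 : ℂ) • A := by
  ext1
  have hA := (mem_so (Fin n) ℂ A.val).1 A.property
  simp only [skewPart, LinearMap.coe_mk, AddHom.coe_mk, hA, SetLike.val_smul]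
  module

theorem skewPart_single_self (i : Fin n) (c : ℂ) : skewPart n (Matrix.single i i c) = 0 := by
  ext1
  simp [skewPart]

theorem skewPart_single (i j k : Fin n) (hij : i ≠ j) (hik : i ≠ k) (hjk : j ≠ k) :
    skewPart n (Matrix.single i j 1) =
      ⁅skewPart n (Matrix.single i k 1), skewPart n (Matrix.single k j 1)⁆ := by
  ext1
  simp [skewPart, Ring.lie_def, mul_sub, sub_mul, hij, hik, hjk, hij.symm, hik.symm, hjk.symm]

/-- `so_n` is perfect for `n ≠ 2`. -/
theorem so_linearMap_eq_zero (hn : n ≠ 2) {V : Type*} [AddCommGroup V] [Module ℂ V]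
    (φ : so (Fin n) ℂ →ₗ[ℂ] V) (hφ : ∀ A B : so (Fin n) ℂ, φ ⁅A, B⁆ = 0) : φ = 0 := by
  have h : φ.comp (skewPart n) = 0 := by
    refine Matrix.ext_linearMap ℂ fun i j => ?_
    ext
    simp only [LinearMap.comp_apply, Matrix.singleLinearMap_apply, LinearMap.zero_apply]
    by_cases hij : i = j
    · rw [hij, skewPart_single_self, map_zero]
    -- Distinct `i`, `j` and `n ≠ 2` force `n ≥ 3`, which leaves a third index.
    · obtain ⟨k, hk⟩ : ∃ k, k ∉ ({i, j} : Finset (Fin n)) := by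
        by_contra! hc
        have h1 : ({i, j} : Finset (Fin n)) = Finset.univ := by ext k; simp [hc k]
        have h2 := congrArg Finset.card h1
        rw [Finset.card_pair hij, Finset.card_fin] at h2
        exact hn h2.symm
      simp only [Finset.mem_insert, Finset.mem_singleton, not_or] at hk
      rw [skewPart_single i j k hij (Ne.symm hk.1) (Ne.symm hk.2), hφ]
  ext A
  have := LinearMap.congr_fun h A.val
  rw [LinearMap.comp_apply, skewPart_val, map_smul] at this
  exact (smul_eq_zero.1 this).resolve_left two_ne_zero

namespace SchrodingerSO

theorem eq_zero_of_isSymmBiderivation (hn : 1 ≤ n) (hn2 : n ≠ 2)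
    {δ : SchrodingerSO n →ₗ[ℂ] SchrodingerSO n →ₗ[ℂ] SchrodingerSO n}
    (hδ : IsSymmBiderivation δ) : δ = 0 := by
  have hlie (x y : SchrodingerSO n) : δ ⁅x, y⁆ = 0 := by
    ext1 b
    rw [hδ.lie_left, lie_apply_eq_zero hn hδ, lie_apply_eq_zero hn hδ, sub_zero,
      LinearMap.zero_apply]
  have hso := so_linearMap_eq_zero hn2 (δ.comp ofSo) fun A B => by
    rw [LinearMap.comp_apply, ← lie_ofSo, hlie]
  have htr := hδ.apply_mem_triple isSl2Triple casimirDetectsInvariants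
  refine LinearMap.ext fun x => ?_
  have hx : x = ofHeis x.left + (x.right.1.val 0 0 • ofSl slH + x.right.1.val 0 1 • ofSl slE +
      x.right.1.val 1 0 • ofSl slF) + ofSo x.right.2 := by
    have := sl_eq_smul_add x.right.1
    apply LieAlgebra.SemiDirectSum.ext
    · simp [ofHeis, ofSl, ofSo]
    · refine Prod.ext ?_ ?_
      · simpa [ofHeis, ofSl, ofSo] using this
      · simp [ofHeis, ofSl, ofSo]
  rw [hx]
  simp only [map_add, map_smul, htr _ (Set.mem_insert _ _), htr (ofSl slE) (by simp),
    htr (ofSl slF) (by simp), apply_ofHeis hn hδ]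
  simpa using LinearMap.congr_fun hso x.right.2

end SchrodingerSO

end SO

/-! ### The algebra with `sp_{2n}`. -/

section Sp

open LieAlgebra.SpecialLinear LieAlgebra.Symplectic HeisenbergAlgebra Matrix

variable {n : ℕ}

theorem fromBlocks_sub_fromBlocks (A B C D A' B' C' D' : Matrix (Fin n) (Fin n) ℂ) :
    fromBlocks A B C D - fromBlocks A' B' C' D' =
      fromBlocks (A - A') (B - B') (C - C') (D - D') := by
  simp [sub_eq_add_neg, fromBlocks_neg, fromBlocks_add]

theorem mem_sp_fromBlocks (A B C D : Matrix (Fin n) (Fin n) ℂ) :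
    fromBlocks A B C D ∈ sp (Fin n) ℂ ↔ D = -Aᵀ ∧ Bᵀ = B ∧ Cᵀ = C := by
  rw [sp, mem_skewAdjointMatricesLieSubalgebra, mem_skewAdjointMatricesSubmodule]
  change _ * _ = _ * _ ↔ _
  simp only [J, fromBlocks_transpose, fromBlocks_multiply, fromBlocks_neg, fromBlocks_inj]
  simp only [mul_zero, mul_one, mul_neg, zero_add, add_zero, zero_mul, one_mul, neg_mul, neg_neg,
    neg_zero]
  constructor
  · rintro ⟨h1, h2, h3, h4⟩
    exact ⟨h2.symm, neg_injective h4, h1⟩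
  · rintro ⟨rfl, h2, h3⟩
    simp [h2, h3]

theorem slSoToSp_slH : (slSoToSp n (slH, 0)).val = fromBlocks 1 0 0 (-1) := by
  simp [slSoToSp, slH]

theorem slSoToSp_slE : (slSoToSp n (slE, 0)).val = fromBlocks 0 1 0 0 := by
  simp [slSoToSp, slE]

theorem slSoToSp_slF : (slSoToSp n (slF, 0)).val = fromBlocks 0 0 1 0 := by
  simp [slSoToSp, slF]

/-- The Casimir operator of `sl₂` on `sp_{2n}` kills only invariants. -/
theorem sp_casimir {M : sp (Fin n) ℂ}
    (hM : ⁅slSoToSp n (slH, 0), ⁅slSoToSp n (slH, 0), M⁆⁆ +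
      (2 : ℂ) • ⁅slSoToSp n (slH, 0), M⁆ +
      (4 : ℂ) • ⁅slSoToSp n (slF, 0), ⁅slSoToSp n (slE, 0), M⁆⁆ = 0) (X : sl (Fin 2) ℂ) :
    ⁅slSoToSp n (X, 0), M⁆ = 0 := by
  obtain ⟨A, B, C, D, h⟩ : ∃ A B C D, M.val = fromBlocks A B C D :=
    ⟨_, _, _, _, (fromBlocks_toBlocks M.val).symm⟩
  have hM' := congrArg Subtype.val hM
  simp only [LieSubalgebra.coe_bracket, AddMemClass.coe_add, SetLike.val_smul, Ring.lie_def, h,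
    slSoToSp_slH, slSoToSp_slE, slSoToSp_slF, fromBlocks_multiply, fromBlocks_smul, fromBlocks_add,
    fromBlocks_sub_fromBlocks, ZeroMemClass.coe_zero, ← fromBlocks_zero, fromBlocks_inj] at hM'
  simp only [mul_zero, mul_one, mul_neg, zero_add, add_zero, zero_mul, one_mul, neg_mul, neg_zero,
    sub_self, zero_sub, sub_zero, smul_zero] at hM'
  obtain ⟨h1, h2, h3, -⟩ := hM'
  -- The Casimir is `8` on the blocks `B` and `C`, of weights `±2`, and its upper left block is `4(A
  -- - D)`. What survives, `B = C = 0` and `D = A`, commutes with `sl₂`.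
  have hB : B = 0 := by
    linear_combination (norm := module) (1 / 8 : ℂ) • h2
  have hC : C = 0 := by
    linear_combination (norm := module) (1 / 8 : ℂ) • h3
  have hD : D = A := by
    linear_combination (norm := module) (-1 / 4 : ℂ) • h1
  ext1
  rw [sl_eq_smul_add X]
  simp [slSoToSp, slH, slE, slF, Ring.lie_def, h, hB, hC, hD, fromBlocks_multiply]

/-- The element of `sp_{2n}` with diagonal blocks `A` and `-Aᵀ`. -/
noncomputable def spDiag (n : ℕ) : Matrix (Fin n) (Fin n) ℂ →ₗ[ℂ] sp (Fin n) ℂ where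
  toFun A := ⟨fromBlocks A 0 0 (-Aᵀ), (mem_sp_fromBlocks _ _ _ _).2 (by simp)⟩
  map_add' A B := by ext1; simp [fromBlocks_add, add_comm]
  map_smul' c A := by ext1; simp [fromBlocks_smul]

/-- The elements of `sp_{2n}` with zero diagonal blocks. -/
noncomputable def spOff (B C : Matrix (Fin n) (Fin n) ℂ) (hB : Bᵀ = B) (hC : Cᵀ = C) :
    sp (Fin n) ℂ :=
  ⟨fromBlocks 0 B C 0, (mem_sp_fromBlocks _ _ _ _).2 ⟨by simp, hB, hC⟩⟩

theorem exists_eq_spDiag_add_spOff (M : sp (Fin n) ℂ) :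
    ∃ A B C hB hC, M = spDiag n A + spOff B C hB hC := by
  obtain ⟨A, B, C, D, h⟩ : ∃ A B C D, M.val = fromBlocks A B C D :=
    ⟨_, _, _, _, (fromBlocks_toBlocks M.val).symm⟩
  obtain ⟨hD, hB, hC⟩ := (mem_sp_fromBlocks A B C D).1 (h ▸ M.property)
  refine ⟨A, B, C, hB, hC, ?_⟩
  ext1
  simp [spDiag, spOff, fromBlocks_add, h, hD]

theorem slH_lie_slH_lie_spOff (B C : Matrix (Fin n) (Fin n) ℂ) (hB : Bᵀ = B) (hC : Cᵀ = C) :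
    ⁅slSoToSp n (slH, 0), ⁅slSoToSp n (slH, 0), spOff B C hB hC⁆⁆ =
      (4 : ℂ) • spOff B C hB hC := by
  ext1
  simp only [LieSubalgebra.coe_bracket, SetLike.val_smul, Ring.lie_def, slSoToSp_slH, spOff,
    fromBlocks_multiply, fromBlocks_sub_fromBlocks, fromBlocks_smul]
  congr 1 <;> simp <;> module

/-- The upper left block of the bracket is `E_ii (E_ij + E_ji)`; the two summands coincide when `i =
j`, hence the factor `2`. Since the factor is never zero, off-diagonal blocks generate all diagonal
ones. -/
theorem lie_spOff_spOff (i j : Fin n) :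
    ⁅spOff (single i i 1) 0 (transpose_single ..) (transpose_zero),
      spOff 0 (single i j 1 + single j i 1) (transpose_zero)
        (by simp [add_comm])⁆ = (if i = j then (2 : ℂ) else 1) • spDiag n (single i j 1) := by
  have h1 : single i i 1 * (single i j 1 + single j i 1) =
      (if i = j then (2 : ℂ) else 1) • single i j (1 : ℂ) := by
    split_ifs with h
    · subst h
      rw [mul_add, single_mul_single_same, mul_one, two_smul]
    · rw [mul_add, single_mul_single_same, single_mul_single_of_ne _ _ _ _ h, mul_one, one_smul,
        add_zero]
  have h2 := congrArg transpose h1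
  simp only [transpose_mul, transpose_add, transpose_smul, transpose_single] at h2
  rw [add_comm] at h2
  generalize (if i = j then (2 : ℂ) else 1) = c at h1 h2 ⊢
  ext1
  simp [spOff, spDiag, Ring.lie_def, fromBlocks_multiply, fromBlocks_smul,
    fromBlocks_sub_fromBlocks, h1, h2, -smul_single]

namespace SchrodingerSp

theorem lie_def (x y : SchrodingerSp n) : ⁅x, y⁆ =
    ⟨⁅x.left, y.left⁆ + spAction n x.right.2 y.left -
      spAction n y.right.2 x.left, ⁅x.right, y.right⁆⟩ := rfl

/-- The diagonal inclusion of `sl₂`, by the identity in `sl₂` and by `ℂ^{2n} = ℂ^2 ⊗ ℂ^n` in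
`sp_{2n}`. -/
noncomputable def diag : sl (Fin 2) ℂ →ₗ[ℂ] SchrodingerSp n where
  toFun X := ⟨0, (X, slSoToSp n (X, 0))⟩
  map_add' X Y := by
    have h : ((X + Y, 0) : sl (Fin 2) ℂ × LieAlgebra.Orthogonal.so (Fin n) ℂ) =
      (X, 0) + (Y, 0) := by simp
    rw [h, map_add]
    simp
  map_smul' c X := by
    have h : ((c • X, 0) : sl (Fin 2) ℂ × LieAlgebra.Orthogonal.so (Fin n) ℂ) =
      c • (X, 0) := by simp
    rw [h, map_smul]
    simp

/-- The inclusion of `H_n`. -/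
noncomputable def ofHeis (v : HeisenbergAlgebra n) : SchrodingerSp n := ⟨v, 0⟩

/-- The inclusion of `sl₂` as a direct summand. -/
noncomputable def ofSl (X : sl (Fin 2) ℂ) : SchrodingerSp n := ⟨0, (X, 0)⟩

/-- The inclusion of `sp_{2n}`. -/
noncomputable def ofSp : sp (Fin n) ℂ →ₗ[ℂ] SchrodingerSp n where
  toFun M := ⟨0, (0, M)⟩
  map_add' A B := by simp
  map_smul' c A := by simp

theorem diag_lie (X : sl (Fin 2) ℂ) (y : SchrodingerSp n) :
    ⁅(diag X : SchrodingerSp n), y⁆ =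
      ⟨spAction n (slSoToSp n (X, 0)) y.left,
        (⁅X, y.right.1⁆, ⁅slSoToSp n (X, 0), y.right.2⁆)⟩ := by
  rw [lie_def]
  simp [diag]

theorem diag_lie_diag (X Y : sl (Fin 2) ℂ) :
    ⁅(diag X : SchrodingerSp n), (diag Y : SchrodingerSp n)⁆ = diag ⁅X, Y⁆ := by
  rw [diag_lie]
  simp [diag, ← LieHom.map_lie]

theorem isSl2Triple : IsSl2Triple (diag slH : SchrodingerSp n) (diag slE) (diag slF) where
  h_ne_zero h := isSl2Triple_sl.h_ne_zero (congrArg (fun x => x.right.1) h)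
  lie_e_f := by rw [diag_lie_diag, isSl2Triple_sl.lie_e_f]
  lie_h_e_nsmul := by rw [diag_lie_diag, isSl2Triple_sl.lie_h_e_nsmul, map_nsmul]
  lie_h_f_nsmul := by rw [diag_lie_diag, isSl2Triple_sl.lie_h_f_nsmul, map_neg, map_nsmul]

theorem casimirDetectsInvariants :
    CasimirDetectsInvariants (diag slH : SchrodingerSp n) (diag slE) (diag slF) := by
  intro x hx
  simp only [diag_lie, LieAlgebra.SemiDirectSum.add_eq_mk, LieAlgebra.SemiDirectSum.smul_eq_mk,
    LieAlgebra.SemiDirectSum.zero_eq_mk, LieAlgebra.SemiDirectSum.mk.injEq, slSoToSp_casimir,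
    Prod.smul_mk, Prod.mk_add_mk, sl_casimir] at hx ⊢
  have h1 : x.left.vec = 0 :=
    congrArg HeisenbergAlgebra.vec ((smul_eq_zero.1 hx.1).resolve_left (by norm_num))
  have h2 : x.right.1 = 0 :=
    (smul_eq_zero.1 (congrArg Prod.fst hx.2)).resolve_left (by norm_num)
  simp only [h2, lie_zero, spAction_eq_zero _ h1, sp_casimir (congrArg Prod.snd hx.2)]
  simp

variable {δ : SchrodingerSp n →ₗ[ℂ] SchrodingerSp n →ₗ[ℂ] SchrodingerSp n}

theorem apply_ofHeis (hn : 1 ≤ n) (hδ : IsSymmBiderivation δ) (v : HeisenbergAlgebra n) :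
    δ (ofHeis v) = 0 := by
  have key (v : Fin n ⊕ Fin n → ℂ) : δ (ofHeis ⟨v, 0⟩) = 0 := by
    rw [← hδ.apply_lie_mem_triple isSl2Triple casimirDetectsInvariants
      (diag slH : SchrodingerSp n) (by simp)
      ⁅(diag slH : SchrodingerSp n), (ofHeis ⟨v, 0⟩ : SchrodingerSp n)⁆]
    congr 1
    rw [diag_lie, diag_lie, ofHeis]
    ext i
    · rcases i with i | i <;> simp [slSoToSp_mulVec_inl, slSoToSp_mulVec_inr, slH]
    · simp
    · simp
    · simp
  obtain ⟨u, w, huw⟩ := exists_omega_eq_one hn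
  have hv : ofHeis v = ofHeis ⟨v.vec, 0⟩ + v.coeff •
      (⁅ofHeis ⟨u, 0⟩, ofHeis ⟨w, 0⟩⁆ : SchrodingerSp n) := by
    rw [lie_def]
    ext i <;> simp [ofHeis, huw]
  rw [hv, map_add, map_smul, hδ.apply_lie_eq_zero (key u) (key w), key, smul_zero, add_zero]

theorem apply_ofSp_spOff (hδ : IsSymmBiderivation δ) (B C : Matrix (Fin n) (Fin n) ℂ)
    (hB : Bᵀ = B) (hC : Cᵀ = C) : δ (ofSp (spOff B C hB hC)) = 0 := by
  have h := hδ.apply_lie_mem_triple isSl2Triple casimirDetectsInvariants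
    (diag slH : SchrodingerSp n) (by simp)
    ⁅(diag slH : SchrodingerSp n), ofSp (spOff B C hB hC)⁆
  -- The off-diagonal blocks have weights `±2`, so `(ad h)²` is `4` on them.
  have h1 : ⁅(diag slH : SchrodingerSp n), ⁅(diag slH : SchrodingerSp n),
      ofSp (spOff B C hB hC)⁆⁆ = (4 : ℂ) • ofSp (spOff B C hB hC) := by
    rw [diag_lie, diag_lie, ← map_smul, ← slH_lie_slH_lie_spOff]
    simp [ofSp]
  rw [h1, map_smul] at h
  exact (smul_eq_zero.1 h).resolve_left (by norm_num)

theorem lie_ofSp (M N : sp (Fin n) ℂ) : ⁅ofSp M, ofSp N⁆ = ofSp ⁅M, N⁆ := by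
  rw [lie_def]
  simp [ofSp]

theorem apply_ofSp (hδ : IsSymmBiderivation δ) (M : sp (Fin n) ℂ) : δ (ofSp M) = 0 := by
  have h : (δ.comp ofSp).comp (spDiag n) = 0 := by
    refine Matrix.ext_linearMap ℂ fun i j => ?_
    refine LinearMap.ext_ring ?_
    simp only [LinearMap.comp_apply, Matrix.singleLinearMap_apply, LinearMap.zero_apply]
    have := hδ.apply_lie_eq_zero
      (apply_ofSp_spOff hδ (single i i 1) 0 (transpose_single ..) transpose_zero)
      (apply_ofSp_spOff hδ 0 (single i j 1 + single j i 1) transpose_zero (by simp [add_comm]))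
    rw [lie_ofSp, lie_spOff_spOff, map_smul, map_smul] at this
    exact (smul_eq_zero.1 this).resolve_left (by split_ifs <;> norm_num)
  obtain ⟨A, B, C, hB, hC, rfl⟩ := exists_eq_spDiag_add_spOff M
  rw [map_add, map_add, apply_ofSp_spOff hδ, add_zero]
  exact LinearMap.congr_fun h A

theorem eq_zero_of_isSymmBiderivation (hn : 1 ≤ n) (hδ : IsSymmBiderivation δ) : δ = 0 := by
  have htr := hδ.apply_mem_triple isSl2Triple casimirDetectsInvariants
  have hdiag (X : sl (Fin 2) ℂ) : δ (diag X) = 0 := by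
    rw [sl_eq_smul_add X]
    simp only [map_add, map_smul, htr _ (Set.mem_insert _ _), htr (diag slE) (by simp),
      htr (diag slF) (by simp), smul_zero, add_zero]
  refine LinearMap.ext fun x => ?_
  -- `diag` already carries an `sp` component, which the last summand corrects.
  have hx : x = ofHeis x.left + diag x.right.1 +
      ofSp (x.right.2 - slSoToSp n (x.right.1, 0)) := by
    simp [ofHeis, diag, ofSp]
  rw [hx, map_add, map_add, apply_ofHeis hn hδ, hdiag, apply_ofSp hδ]
  simp

end SchrodingerSp

end Sp

theorem mainTheorem11 (n : ℕ) (hn : 1 ≤ n) :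
    (∀ δ : SchrodingerSp n →ₗ[ℂ] SchrodingerSp n →ₗ[ℂ] SchrodingerSp n,
      IsSymmBiderivation δ → δ = 0) ∧
    (n ≠ 2 → ∀ δ : SchrodingerSO n →ₗ[ℂ] SchrodingerSO n →ₗ[ℂ] SchrodingerSO n,
      IsSymmBiderivation δ → δ = 0) :=
  ⟨fun _ hδ => SchrodingerSp.eq_zero_of_isSymmBiderivation hn hδ,
    fun hn2 _ hδ => SchrodingerSO.eq_zero_of_isSymmBiderivation hn hn2 hδ⟩
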